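/- Let $\alpha>0$, $R>0$ and let $\mathbb{D}_R$ be the disk of radius $R$ around the origin of the hyperbolic plane (curvature $-1$), in polar coordinates $(\phi,r)$ with $r$ the hyperbolic distance to the origin. A random point of $\mathbb{D}_R$ has an angle $\phi$ uniform on $[0,2\pi)$ and, independently, a radius $r\in[0,R]$ with density $\alpha\sinh(\alpha r)/(\cosh(\alpha R)-1)$. The polar quadtree with leaf capacity $\kappa\ge 1$ holding the points $x_1,\dots,x_n$ is the following tree of cells $[\phi_0,\phi_1)\times[r_0,r_1)$. The root is $[0,2\pi)\times[0,R)$, and a cell containing more than $\kappa$ of the points is split into four children, at the angle $(\phi_0+\phi_1)/2$ and at the radius $\frac1\alpha\operatorname{arcosh}\frac{\cosh(\alpha r_0)+\cosh(\alpha r_1)}{2}$; cells that are not split are leaf cells. A bottom leaf cell is a leaf cell that has no non-leaf sibling. Map points to the Poincaré disk by $(\phi,r)\mapsto\sqrt{\frac{\cosh r-1}{\cosh r+1}}\,e^{i\phi}$. A range query is given by a Euclidean circle in the plane of the Poincaré disk. It returns the set $A$ of those points $x_i$ whose images lie strictly inside the circle. It starts by examining the root and, from an examined non-leaf cell, goes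 on to examine those children whose images meet the closed disk bounded by the circle. There are constants $K$ and $N$ such that for all $n\ge N$, all $\alpha,R>0$ and all leaf capacities $\kappa\ge1$, the following holds with probability at least $1-1/n$ for the polar quadtree holding $n$ independent random points of $\mathbb{D}_R$ distributed as above: every range query on it examines at most $K(\sqrt n+|A|)$ bottom leaf cells, where $A$ is the set of points that the query returns. -/

import Mathlib

open MeasureTheory

noncomputable section

namespace PolarQuadtree

/-- A point of the hyperbolic plane in native polar coordinates `(φ, r)`: `r` is the hyperbolic
distance to the origin. -/
abbrev PolarPoint : Type := ℝ × ℝ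

/-- The density of the radial coordinate on `[0, R]` with growth parameter `α`. -/
def radialDensity (α R r : ℝ) : ℝ :=
  α * Real.sinh (α * r) / (Real.cosh (α * R) - 1)

/-- The law of the radial coordinate. -/
def radialLaw (α R : ℝ) : Measure ℝ :=
  (volume.restrict (Set.Icc 0 R)).withDensity fun r => ENNReal.ofReal (radialDensity α R r)

/-- The law of the angular coordinate: uniform on `[0, 2π)`. -/
def angularLaw : Measure ℝ :=
  ProbabilityTheory.cond volume (Set.Ico 0 (2 * Real.pi))

/-- The law of a random vertex on the hyperbolic disk of radius `R`: the angular and the radial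
coordinate are independent. -/
def pointLaw (α R : ℝ) : Measure PolarPoint :=
  angularLaw.prod (radialLaw α R)

/-- The map from native polar coordinates to the Poincaré disk, a subset of `ℂ`. -/
def toPoincare (p : PolarPoint) : ℂ :=
  (Real.sqrt ((Real.cosh p.2 - 1) / (Real.cosh p.2 + 1)) : ℂ) * Complex.exp (p.1 * Complex.I)

/-- A cell of the quadtree, delimited by two angles and two radii (in native coordinates). -/
structure Cell where
  minPhi : ℝ
  maxPhi : ℝ
  minR : ℝ
  maxR : ℝ

namespace Cell

/-- The points, in native polar coordinates, for which the cell is responsible. -/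
def region (C : Cell) : Set PolarPoint :=
  Set.Ico C.minPhi C.maxPhi ×ˢ Set.Ico C.minR C.maxR

/-- The angle at which the cell is split. -/
def midPhi (C : Cell) : ℝ := (C.maxPhi + C.minPhi) / 2

/-- The radius at which the cell is split. -/
def midR (α : ℝ) (C : Cell) : ℝ :=
  Real.arcosh ((Real.cosh (α * C.maxR) + Real.cosh (α * C.minR)) / 2) / α

/-- The four children of a cell; the first bit of `q` selects the angular half, the second bit the
radial half. -/
def child (α : ℝ) (C : Cell) (q : Bool × Bool) : Cell where
  minPhi := if q.1 then C.midPhi else C.minPhi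
  maxPhi := if q.1 then C.maxPhi else C.midPhi
  minR := if q.2 then C.midR α else C.minR
  maxR := if q.2 then C.maxR else C.midR α

end Cell

/-- A position in the infinite 4-ary tree, as the list of the choices made on the way from the
root, the last choice first. -/
abbrev Address : Type := List (Bool × Bool)

/-- The cell at a given address of the polar quadtree on the disk of radius `R`. -/
def cellAt (α R : ℝ) : Address → Cell
  | [] => ⟨0, 2 * Real.pi, 0, R⟩
  | q :: a => (cellAt α R a).child α q

section Tree

variable (α R : ℝ) (κ : ℕ) {n : ℕ} (x : Fin n → PolarPoint)

/-- The number of the points `x 0, …, x (n - 1)` in the cell at address `a`. -/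
def load (a : Address) : ℕ :=
  Set.ncard {i : Fin n | x i ∈ (cellAt α R a).region}

/-- The nodes of the polar quadtree with leaf capacity `κ` that holds the points `x`: the root is a
node, and a node whose capacity is exceeded is split into four children. -/
inductive IsNode : Address → Prop
  | root : IsNode []
  | child (a : Address) (q : Bool × Bool) :
      IsNode a → κ < load α R x a → IsNode (q :: a)

/-- Leaf cells are the nodes that are not split. -/
def IsLeaf (a : Address) : Prop :=
  IsNode α R κ x a ∧ load α R x a ≤ κ

/-- Two different addresses with the same parent. -/
def IsSibling (a b : Address) : Prop :=
  ∃ (p : Address) (q q' : Bool × Bool), q ≠ q' ∧ a = q :: p ∧ b = q' :: p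

/-- Bottom leaf cells are the leaf cells that do not have non-leaf siblings. -/
def IsBottomLeaf (a : Address) : Prop :=
  IsLeaf α R κ x a ∧ ∀ b, IsSibling a b → IsNode α R κ x b → IsLeaf α R κ x b

/-- The points returned by the range query for the Euclidean circle with centre `c` and radius `ρ`
in the Poincaré disk. -/
def queryResult (c : ℂ) (ρ : ℝ) : Set (Fin n) :=
  {i | toPoincare (x i) ∈ Metric.ball c ρ}

/-- The nodes examined by that range query: the traversal starts at the root, and from a node that
is not a leaf it descends into those children whose cells meet the circle or its interior. -/
inductive Examined (c : ℂ) (ρ : ℝ) : Address → Prop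
  | root : Examined c ρ []
  | child (a : Address) (q : Bool × Bool) :
      Examined c ρ a → κ < load α R x a →
      (toPoincare '' (cellAt α R (q :: a)).region ∩ Metric.closedBall c ρ).Nonempty →
      Examined c ρ (q :: a)

/-- The bottom leaf cells examined by the range query. -/
def examinedBottomLeaves (c : ℂ) (ρ : ℝ) : Set Address :=
  {a | IsBottomLeaf α R κ x a ∧ Examined α R κ x c ρ a}

end Tree

end PolarQuadtree

end

/-!
Cut the disk into an `m × m` grid of cells of equal mass, where `m` is a power of two of order
`√n`. The tree cells at depth `log₂ m` are exactly these grid cells. Writing `s` for the Euclidean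
norm of the image of a point, the law of cosines shows that the points of a circle satisfy
`s + k / s = 2 ‖c‖ cos (φ - arg c)` with `k = ‖c‖² - ρ²`, so a circle splits into eight arcs on
each of which the radius is a monotone function of the angle or conversely. The grid cells met by
such an arc form a monotone curve of at most `2 m` cells, and there are only exponentially many
such curves in `m`. Hence, by a union bound, with probability at least `1 - 1 / n` every one of
them, and therefore every circle of the plane at once, has only `O(m)` of the sample points in the
grid cells that it meets.

The parents of bottom leaf cells have disjoint cells that all contain a sample point. Such a cell
that meets the query disk lies inside the circle, and its points are then returned by the query,
or it meets the circle. In the latter case it is either shallow, and contains a grid cell meeting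
the circle, or deep, and contained in such a grid cell; there are `O(m)` cells of either kind.
-/

open scoped Finset

namespace PolarQuadtree

theorem encard_le_encard_of_pairwiseDisjoint {ι β : Type*} {s : Set ι} {A : ι → Set β}
    {t : Set β} (hA : s.PairwiseDisjoint A) (h : ∀ a ∈ s, (A a ∩ t).Nonempty) :
    s.encard ≤ t.encard := by
  choose y hy using h
  refine Function.Embedding.encard_le ⟨fun a : s => ⟨y a a.2, (hy a a.2).2⟩, fun a b hab => ?_⟩
  have hyab : y a a.2 = y b b.2 := congrArg Subtype.val hab
  exact Subtype.ext (hA.elim_set a.2 b.2 _ (hy a a.2).1 (hyab ▸ (hy b b.2).1))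

theorem encard_le_card_mul_of_subset_iUnion {ι β : Type*} [Fintype ι] {s : Set β} {A : ι → Set β}
    {t : ℕ} (hs : s ⊆ ⋃ i, A i) (hA : ∀ i, (A i).encard ≤ t) :
    s.encard ≤ (Fintype.card ι * t : ℕ) := by
  calc s.encard ≤ ∑ i, (A i).encard :=
        (Set.encard_le_encard hs).trans (Set.encard_iUnion_le_of_fintype _)
    _ ≤ (Fintype.card ι * t : ℕ) := by
        simpa using Finset.sum_le_card_nsmul Finset.univ _ _ fun i _ => hA i

theorem subset_ball_or_inter_sphere_nonempty {E : Type*} [PseudoMetricSpace E] {s : Set E}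
    {c : E} {ρ : ℝ} (hs : IsPreconnected s) (h : (s ∩ Metric.closedBall c ρ).Nonempty) :
    s ⊆ Metric.ball c ρ ∨ (s ∩ Metric.sphere c ρ).Nonempty := by
  refine or_iff_not_imp_left.2 fun hsub => ?_
  obtain ⟨z, hzs, hz⟩ := Set.not_subset.1 hsub
  obtain ⟨w, hws, hw⟩ := h
  exact hs.intermediate_value (f := (dist · c)) hws hzs (by fun_prop) ⟨hw, not_lt.1 hz⟩

section MonotoneCurves

variable {α β : Type*} [LinearOrder α] [LinearOrder β]

/-- A set of pairs along which both coordinates increase strictly together. -/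
def IsStrictChain (s : Set (α × β)) : Prop :=
  IsChain (fun p q => p.1 < q.1 ∧ p.2 < q.2) s

theorem strictMonoOn_card_filter_lt (s : Finset α) :
    StrictMonoOn (fun a => #{b ∈ s | b < a}) s := by
  refine fun a ha b _ hab => Finset.card_lt_card ?_
  refine Finset.ssubset_iff_of_subset (fun c hc => ?_) |>.2 ⟨a, by simp_all, by simp⟩
  simp only [Finset.mem_filter] at hc ⊢
  exact ⟨hc.1, hc.2.trans hab⟩

theorem fst_lt_iff_snd_lt_of_isStrictChain {s : Set (α × β)}
    (hs : IsStrictChain s) {p q : α × β} (hp : p ∈ s) (hq : q ∈ s) :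
    p.1 < q.1 ↔ p.2 < q.2 := by
  obtain rfl | hpq := eq_or_ne p q
  · simp
  · grind [hs hp hq hpq]

theorem injOn_fst_of_isStrictChain {s : Set (α × β)}
    (hs : IsStrictChain s) : Set.InjOn Prod.fst s := by
  intro p hp q hq hpq
  by_contra hne
  grind [hs hp hq hne]

theorem injOn_snd_of_isStrictChain {s : Set (α × β)}
    (hs : IsStrictChain s) : Set.InjOn Prod.snd s := by
  intro p hp q hq hpq
  by_contra hne
  grind [hs hp hq hne]

theorem card_image_fst_filter_lt {s : Finset (α × β)}
    (hs : IsStrictChain (s : Set (α × β))) {p : α × β} (hp : p ∈ s) :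
    #{a ∈ s.image Prod.fst | a < p.1} = #{b ∈ s.image Prod.snd | b < p.2} := by
  rw [Finset.filter_image, Finset.filter_image, Finset.card_image_of_injOn,
    Finset.card_image_of_injOn]
  · exact congrArg _ (Finset.filter_congr fun q hq => fst_lt_iff_snd_lt_of_isStrictChain hs hq hp)
  · exact (injOn_snd_of_isStrictChain hs).mono (Finset.filter_subset _ _)
  · exact (injOn_fst_of_isStrictChain hs).mono (Finset.filter_subset _ _)

theorem subset_of_isStrictChain_of_image_eq {s t : Finset (α × β)}
    (hs : IsStrictChain (s : Set (α × β)))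
    (ht : IsStrictChain (t : Set (α × β)))
    (h₁ : s.image Prod.fst = t.image Prod.fst) (h₂ : s.image Prod.snd = t.image Prod.snd) :
    s ⊆ t := by
  intro p hp
  obtain ⟨q, hq, hqp⟩ : ∃ q ∈ t, q.1 = p.1 :=
    Finset.mem_image.1 (h₁ ▸ Finset.mem_image_of_mem _ hp)
  have hcard : #{b ∈ s.image Prod.snd | b < p.2} = #{b ∈ s.image Prod.snd | b < q.2} := by
    rw [← card_image_fst_filter_lt hs hp, h₁, h₂, ← hqp, card_image_fst_filter_lt ht hq]
  have hsnd : p.2 = q.2 := (strictMonoOn_card_filter_lt _).injOn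
    (Finset.mem_image_of_mem _ hp) (h₂ ▸ Finset.mem_image_of_mem _ hq) hcard
  exact Prod.ext hqp.symm hsnd ▸ hq

theorem eq_of_isStrictChain_of_image_eq {s t : Finset (α × β)}
    (hs : IsStrictChain (s : Set (α × β)))
    (ht : IsStrictChain (t : Set (α × β)))
    (h₁ : s.image Prod.fst = t.image Prod.fst) (h₂ : s.image Prod.snd = t.image Prod.snd) :
    s = t :=
  (subset_of_isStrictChain_of_image_eq hs ht h₁ h₂).antisymm
    (subset_of_isStrictChain_of_image_eq ht hs h₁.symm h₂.symm)

theorem card_le_of_isStrictChain {a b : ℕ} {s : Finset (ℕ × ℕ)}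
    (hs : IsStrictChain (s : Set (ℕ × ℕ))) (hsub : s ⊆ Finset.range a ×ˢ Finset.range b) :
    #s ≤ a := by
  rw [← Finset.card_image_of_injOn (injOn_fst_of_isStrictChain hs)]
  refine (Finset.card_le_card fun k hk => ?_).trans_eq (Finset.card_range a)
  obtain ⟨p, hp, rfl⟩ := Finset.mem_image.1 hk
  exact (Finset.mem_product.1 (hsub hp)).1

theorem card_le_two_pow_of_isStrictChain {a b : ℕ} {𝒯 : Finset (Finset (ℕ × ℕ))}
    (h𝒯 : ∀ s ∈ 𝒯, IsStrictChain (s : Set (ℕ × ℕ)) ∧ s ⊆ Finset.range a ×ˢ Finset.range b) :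
    #𝒯 ≤ 2 ^ (a + b) := by
  have hmaps : ∀ s ∈ 𝒯, (s.image Prod.fst, s.image Prod.snd) ∈
      (Finset.range a).powerset ×ˢ (Finset.range b).powerset := fun s hs => by
    rw [Finset.mem_product, Finset.mem_powerset, Finset.mem_powerset]
    exact ⟨(Finset.image_subset_image (h𝒯 s hs).2).trans Finset.subset_product_image_fst,
      (Finset.image_subset_image (h𝒯 s hs).2).trans Finset.subset_product_image_snd⟩
  have hinj : Set.InjOn (fun s : Finset (ℕ × ℕ) => (s.image Prod.fst, s.image Prod.snd)) 𝒯 :=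
    fun s hs t ht hst => eq_of_isStrictChain_of_image_eq (h𝒯 s hs).1 (h𝒯 t ht).1
      (Prod.ext_iff.1 hst).1 (Prod.ext_iff.1 hst).2
  calc #𝒯 ≤ #((Finset.range a).powerset ×ˢ (Finset.range b).powerset) :=
        Finset.card_le_card_of_injOn _ hmaps hinj
    _ = 2 ^ (a + b) := by simp [pow_add]

/-- Coordinatewise monotone curves: sets of pairs along which the second coordinate is a weakly
increasing or a weakly decreasing function of the first, vertical segments being allowed. -/
def IsMonotoneCurve (s : Set (α × β)) : Prop :=
  IsChain (· ≤ ·) s ∨ IsChain (fun p q => q.1 ≤ p.1 ∧ p.2 ≤ q.2) s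

theorem IsMonotoneCurve.image {γ δ : Type*} [LinearOrder γ] [LinearOrder δ] {s : Set (α × β)}
    (hs : IsMonotoneCurve s) {f : α → γ} {g : β → δ} (hf : Monotone f)
    (hg : MonotoneOn g (Prod.snd '' s)) : IsMonotoneCurve (Prod.map f g '' s) := by
  have hg' : ∀ p ∈ s, ∀ q ∈ s, p.2 ≤ q.2 → g p.2 ≤ g q.2 := fun p hp q hq =>
    hg (Set.mem_image_of_mem _ hp) (Set.mem_image_of_mem _ hq)
  refine hs.imp ?_ ?_ <;> rintro h _ ⟨p, hp, rfl⟩ _ ⟨q, hq, rfl⟩ hpq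
  · have := h hp hq (ne_of_apply_ne _ hpq)
    exact this.imp (fun h => ⟨hf h.1, hg' p hp q hq h.2⟩) fun h => ⟨hf h.1, hg' q hq p hp h.2⟩
  · have := h hp hq (ne_of_apply_ne _ hpq)
    exact this.imp (fun h => ⟨hf h.1, hg' p hp q hq h.2⟩) fun h => ⟨hf h.1, hg' q hq p hp h.2⟩

theorem isMonotoneCurve_of_forall_snd_eq {s : Set (α × β)}
    (hs : ∀ p ∈ s, ∀ q ∈ s, p.2 = q.2) : IsMonotoneCurve s :=
  Or.inl fun p hp q hq _ => (le_total p.1 q.1).imp (fun h => ⟨h, (hs p hp q hq).le⟩)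
    fun h => ⟨h, (hs q hq p hp).le⟩

theorem isMonotoneCurve_of_eq {γ : Type*} [Preorder γ] {s : Set (α × β)} {u : α → γ} {v : β → γ}
    {I : Set α} {J : Set β} (hs : s ⊆ I ×ˢ J) (hu : StrictMonoOn u I ∨ StrictAntiOn u I)
    (hv : MonotoneOn v J ∨ AntitoneOn v J) (huv : ∀ p ∈ s, u p.1 = v p.2) :
    IsMonotoneCurve s := by
  have hcases : (∀ p ∈ s, ∀ q ∈ s, p.2 ≤ q.2 → p.1 ≤ q.1) ∨
      ∀ p ∈ s, ∀ q ∈ s, p.2 ≤ q.2 → q.1 ≤ p.1 := by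
    obtain hu | hu := hu <;> obtain hv | hv := hv
    · refine Or.inl fun p hp q hq h => (hu.le_iff_le (hs hp).1 (hs hq).1).1 ?_
      exact huv p hp ▸ huv q hq ▸ hv (hs hp).2 (hs hq).2 h
    · refine Or.inr fun p hp q hq h => (hu.le_iff_le (hs hq).1 (hs hp).1).1 ?_
      exact huv p hp ▸ huv q hq ▸ hv (hs hp).2 (hs hq).2 h
    · refine Or.inr fun p hp q hq h => (hu.le_iff_ge (hs hp).1 (hs hq).1).1 ?_
      exact huv p hp ▸ huv q hq ▸ hv (hs hp).2 (hs hq).2 h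
    · refine Or.inl fun p hp q hq h => (hu.le_iff_ge (hs hq).1 (hs hp).1).1 ?_
      exact huv p hp ▸ huv q hq ▸ hv (hs hp).2 (hs hq).2 h
  refine hcases.imp (fun h p hp q hq _ => ?_) fun h p hp q hq _ => ?_
  · exact (le_total p.2 q.2).imp (fun hle => ⟨h p hp q hq hle, hle⟩)
      fun hle => ⟨h q hq p hp hle, hle⟩
  · exact (le_total p.2 q.2).imp (fun hle => ⟨h p hp q hq hle, hle⟩)
      fun hle => ⟨h q hq p hp hle, hle⟩

end MonotoneCurves

section GridCurves

open scoped Classical in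
/-- The monotone curves in the `m × m` grid. -/
noncomputable def gridCurves (m : ℕ) : Finset (Finset (ℕ × ℕ)) :=
  {T ∈ (Finset.range m ×ˢ Finset.range m).powerset | IsMonotoneCurve (T : Set (ℕ × ℕ))}

theorem mem_gridCurves {m : ℕ} {T : Finset (ℕ × ℕ)} :
    T ∈ gridCurves m ↔
      T ⊆ Finset.range m ×ˢ Finset.range m ∧ IsMonotoneCurve (T : Set (ℕ × ℕ)) := by
  simp [gridCurves]

/-- The shear `(i, j) ↦ (i + j, 2 i + j)`, after the reflection `i ↦ m - i` if `b` holds: it turns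
every monotone curve of the `m × m` grid, for one of the two values of `b`, into a strict chain. -/
def gridShear (m : ℕ) (b : Bool) (p : ℕ × ℕ) : ℕ × ℕ :=
  if b then (m - p.1 + p.2, 2 * (m - p.1) + p.2) else (p.1 + p.2, 2 * p.1 + p.2)

theorem injOn_gridShear (m : ℕ) (b : Bool) :
    Set.InjOn (gridShear m b) ↑(Finset.range m ×ˢ Finset.range m) := by
  intro p hp q hq h
  simp only [Finset.coe_product, Finset.coe_range, Set.mem_prod, Set.mem_Iio] at hp hq
  cases b <;> simp only [gridShear, Bool.false_eq_true, if_true, if_false, Prod.ext_iff] at h ⊢ <;>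
    lia

theorem image_gridShear_subset {m : ℕ} (b : Bool) {T : Finset (ℕ × ℕ)}
    (hT : T ⊆ Finset.range m ×ˢ Finset.range m) :
    T.image (gridShear m b) ⊆ Finset.range (2 * m) ×ˢ Finset.range (3 * m) := by
  refine Finset.image_subset_iff.2 fun p hp => ?_
  have hpm := hT hp
  simp only [Finset.mem_product, Finset.mem_range] at hpm ⊢
  cases b <;> simp only [gridShear, Bool.false_eq_true, if_true, if_false] <;> lia

theorem exists_isStrictChain_image_gridShear {m : ℕ} {T : Finset (ℕ × ℕ)} (hT : T ∈ gridCurves m) :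
    ∃ b, IsStrictChain (gridShear m b '' T) := by
  obtain ⟨hsub, hchain | hchain⟩ := mem_gridCurves.1 hT
  · refine ⟨false, ?_⟩
    rintro _ ⟨p, hp, rfl⟩ _ ⟨q, hq, rfl⟩ hpq
    have hne : p ≠ q := ne_of_apply_ne _ hpq
    have := hchain hp hq hne
    simp only [gridShear, Prod.le_def, Bool.false_eq_true, if_false, ne_eq, Prod.ext_iff] at *
    lia
  · refine ⟨true, ?_⟩
    rintro _ ⟨p, hp, rfl⟩ _ ⟨q, hq, rfl⟩ hpq
    have hne : p ≠ q := ne_of_apply_ne _ hpq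
    have hpm := Finset.mem_product.1 (hsub hp)
    have hqm := Finset.mem_product.1 (hsub hq)
    have := hchain hp hq hne
    simp only [gridShear, Finset.mem_range, if_true, ne_eq, Prod.ext_iff] at *
    lia

theorem card_le_of_mem_gridCurves {m : ℕ} {T : Finset (ℕ × ℕ)} (hT : T ∈ gridCurves m) :
    #T ≤ 2 * m := by
  obtain ⟨hsub, -⟩ := mem_gridCurves.1 hT
  obtain ⟨b, hb⟩ := exists_isStrictChain_image_gridShear hT
  rw [← Finset.card_image_of_injOn ((injOn_gridShear m b).mono hsub)]
  exact card_le_of_isStrictChain (by rwa [Finset.coe_image]) (image_gridShear_subset b hsub)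

theorem card_gridCurves_le (m : ℕ) : #(gridCurves m) ≤ 2 * 32 ^ m := by
  classical
  let curves (b : Bool) : Finset (Finset (ℕ × ℕ)) :=
    {T ∈ gridCurves m | IsStrictChain (gridShear m b '' T)}
  have hcurves : ∀ b, #(curves b) ≤ 2 ^ (2 * m + 3 * m) := fun b => by
    have hinj : Set.InjOn (Finset.image (gridShear m b)) (curves b) :=
      (Finset.image_injOn_powerset_of_injOn (injOn_gridShear m b)).mono fun T hT =>
        Finset.mem_powerset.2 (mem_gridCurves.1 (Finset.mem_filter.1 hT).1).1
    rw [← Finset.card_image_of_injOn hinj]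
    refine card_le_two_pow_of_isStrictChain fun S hS => ?_
    obtain ⟨T, hT, rfl⟩ := Finset.mem_image.1 hS
    obtain ⟨hT, hchain⟩ := Finset.mem_filter.1 hT
    exact ⟨by rwa [Finset.coe_image], image_gridShear_subset b (mem_gridCurves.1 hT).1⟩
  calc #(gridCurves m) ≤ #(Finset.univ.biUnion curves) := Finset.card_le_card fun T hT => by
        obtain ⟨b, hb⟩ := exists_isStrictChain_image_gridShear hT
        exact Finset.mem_biUnion.2 ⟨b, Finset.mem_univ b, Finset.mem_filter.2 ⟨hT, hb⟩⟩
    _ ≤ #(Finset.univ : Finset Bool) * 2 ^ (2 * m + 3 * m) :=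
        Finset.card_biUnion_le_card_mul _ _ _ fun b _ => hcurves b
    _ = 2 * 32 ^ m := by rw [Finset.card_univ, Fintype.card_bool, ← add_mul, pow_mul]; norm_num

end GridCurves

section Circle

/-- The distance to the origin in the Poincaré disk, as a function of the hyperbolic one. -/
noncomputable def poincareRadius (r : ℝ) : ℝ :=
  √((Real.cosh r - 1) / (Real.cosh r + 1))

theorem poincareRadius_nonneg (r : ℝ) : 0 ≤ poincareRadius r := Real.sqrt_nonneg _

theorem strictMonoOn_poincareRadius : StrictMonoOn poincareRadius (Set.Ici 0) := by
  intro r hr r' hr' h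
  have hcosh : Real.cosh r < Real.cosh r' := Real.cosh_strictMonoOn hr hr' h
  have hone := Real.one_le_cosh r
  refine Real.sqrt_lt_sqrt (div_nonneg (by linarith) (by linarith)) ?_
  rw [div_lt_div_iff₀ (by linarith) (by linarith)]
  nlinarith

theorem continuous_toPoincare : Continuous toPoincare := by
  have hcosh (p : PolarPoint) : Real.cosh p.2 + 1 ≠ 0 := by
    have := Real.one_le_cosh p.2
    positivity
  unfold toPoincare
  fun_prop (disch := exact hcosh)

theorem norm_sq_toPoincare_sub (y : PolarPoint) (c : ℂ) :
    ‖toPoincare y - c‖ ^ 2 = poincareRadius y.2 ^ 2 -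
      2 * poincareRadius y.2 * ‖c‖ * Real.cos (y.1 - c.arg) + ‖c‖ ^ 2 := by
  have hre : (toPoincare y).re = poincareRadius y.2 * Real.cos y.1 := by
    simp [toPoincare, poincareRadius, Complex.exp_ofReal_mul_I_re]
  have him : (toPoincare y).im = poincareRadius y.2 * Real.sin y.1 := by
    simp [toPoincare, poincareRadius, Complex.exp_ofReal_mul_I_im]
  rw [Complex.sq_norm, Complex.normSq_apply, Complex.sub_re, Complex.sub_im, hre, him,
    ← Complex.norm_mul_cos_arg c, ← Complex.norm_mul_sin_arg c, Real.cos_sub]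
  linear_combination poincareRadius y.2 ^ 2 * Real.sin_sq_add_cos_sq y.1 +
    ‖c‖ ^ 2 * Real.sin_sq_add_cos_sq c.arg

/-- The `k`-th half-period of `φ ↦ cos (φ - θ)`, counted so that `θ` is the right end of the `0`-th
one. -/
def halfPeriod (θ : ℝ) (k : ℕ) : Set ℝ :=
  {φ | φ - θ ∈ Set.Icc ((k - 1) * Real.pi) (k * Real.pi)}

theorem strictMonoOn_or_strictAntiOn_cos_sub (θ : ℝ) (k : ℕ) :
    StrictMonoOn (fun φ => Real.cos (φ - θ)) (halfPeriod θ k) ∨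
      StrictAntiOn (fun φ => Real.cos (φ - θ)) (halfPeriod θ k) := by
  have hcos {φ ψ : ℝ} (hφ : φ ∈ halfPeriod θ k) (hψ : ψ ∈ halfPeriod θ k) (h : φ < ψ) :
      (-1) ^ k * Real.cos (φ - θ) < (-1) ^ k * Real.cos (ψ - θ) := by
    rw [← Real.cos_nat_mul_pi_sub, ← Real.cos_nat_mul_pi_sub]
    exact Real.strictAntiOn_cos ⟨by linarith [hψ.2], by linarith [hψ.1]⟩
      ⟨by linarith [hφ.2], by linarith [hφ.1]⟩ (by linarith)
  obtain h | h := neg_one_pow_eq_or ℝ k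
  · exact Or.inl fun φ hφ ψ hψ hφψ => by simpa [h] using hcos hφ hψ hφψ
  · exact Or.inr fun φ hφ ψ hψ hφψ => by simpa [h] using hcos hφ hψ hφψ

theorem exists_mem_halfPeriod {θ φ : ℝ} (hθ : θ ∈ Set.Ioc (-Real.pi) Real.pi)
    (hφ : φ ∈ Set.Ico 0 (2 * Real.pi)) : ∃ i : Fin 4, φ ∈ halfPeriod θ i := by
  obtain ⟨⟨hθ₁, hθ₂⟩, hφ₁, hφ₂⟩ := And.intro hθ hφ
  simp only [halfPeriod, Set.mem_ofPred_eq, Set.mem_Icc]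
  by_cases h₀ : φ - θ ≤ 0
  · exact ⟨0, by norm_num; constructor <;> linarith⟩
  by_cases h₁ : φ - θ ≤ Real.pi
  · exact ⟨1, by norm_num; constructor <;> linarith⟩
  by_cases h₂ : φ - θ ≤ 2 * Real.pi
  · exact ⟨2, by norm_num; constructor <;> linarith⟩
  · exact ⟨3, by norm_num; constructor <;> linarith⟩

theorem add_div_sub_add_div {s t : ℝ} (k : ℝ) (hs : s ≠ 0) (ht : t ≠ 0) :
    t + k / t - (s + k / s) = (t - s) * (s * t - k) / (s * t) := by
  field_simp
  ring

theorem antitoneOn_add_div (k : ℝ) : AntitoneOn (fun s => s + k / s) {s | 0 < s ∧ s ^ 2 ≤ k} := by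
  rintro s ⟨hs, -⟩ t ⟨ht, htk⟩ hst
  rw [← sub_nonpos, add_div_sub_add_div k hs.ne' ht.ne']
  refine div_nonpos_of_nonpos_of_nonneg ?_ (by positivity)
  exact mul_nonpos_of_nonneg_of_nonpos (sub_nonneg.2 hst) (by nlinarith)

theorem monotoneOn_add_div (k : ℝ) : MonotoneOn (fun s => s + k / s) {s | 0 < s ∧ k ≤ s ^ 2} := by
  rintro s ⟨hs, hsk⟩ t ⟨ht, -⟩ hst
  rw [← sub_nonneg, add_div_sub_add_div k hs.ne' ht.ne']
  refine div_nonneg ?_ (by positivity)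
  exact mul_nonneg (sub_nonneg.2 hst) (by nlinarith)

/-- The polar coordinates of the points of the disk, which is the region of the root cell. -/
def rootRegion (R : ℝ) : Set PolarPoint :=
  Set.Ico 0 (2 * Real.pi) ×ˢ Set.Ico 0 R

/-- The points of the disk that are mapped to a given circle of the Poincaré disk. -/
def circlePoints (R : ℝ) (c : ℂ) (ρ : ℝ) : Set PolarPoint :=
  rootRegion R ∩ toPoincare ⁻¹' Metric.sphere c ρ

theorem poincareRadius_sq_add_of_mem_circlePoints {R : ℝ} {c : ℂ} {ρ : ℝ} {y : PolarPoint}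
    (hy : y ∈ circlePoints R c ρ) :
    poincareRadius y.2 ^ 2 + (‖c‖ ^ 2 - ρ ^ 2) =
      2 * poincareRadius y.2 * ‖c‖ * Real.cos (y.1 - c.arg) := by
  have hρ : ‖toPoincare y - c‖ = ρ := mem_sphere_iff_norm.1 hy.2
  have := norm_sq_toPoincare_sub y c
  rw [hρ] at this
  linarith

theorem norm_sq_eq_sq_of_poincareRadius_eq_zero {R : ℝ} {c : ℂ} {ρ : ℝ} {y : PolarPoint}
    (hy : y ∈ circlePoints R c ρ) (h : poincareRadius y.2 = 0) : ‖c‖ ^ 2 - ρ ^ 2 = 0 := by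
  simpa [h] using poincareRadius_sq_add_of_mem_circlePoints hy

theorem isMonotoneCurve_of_poincareRadius_sq_eq {R : ℝ} {s : Set PolarPoint}
    (hs : s ⊆ rootRegion R) {a : ℝ} (ha : ∀ y ∈ s, poincareRadius y.2 ^ 2 = a) :
    IsMonotoneCurve s := by
  refine isMonotoneCurve_of_forall_snd_eq fun y hy z hz => ?_
  refine strictMonoOn_poincareRadius.injOn (hs hy).2.1 (hs hz).2.1 ?_
  exact (sq_eq_sq₀ (poincareRadius_nonneg _) (poincareRadius_nonneg _)).1
    ((ha y hy).trans (ha z hz).symm)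

theorem isMonotoneCurve_of_subset_circlePoints {R : ℝ} {c : ℂ} {ρ : ℝ} {s : Set PolarPoint}
    (hs : s ⊆ circlePoints R c ρ) {k : ℕ} (hφ : ∀ y ∈ s, y.1 ∈ halfPeriod c.arg k) (hc : c ≠ 0)
    (hpos : ∀ y ∈ s, 0 < poincareRadius y.2)
    (hside : (∀ y ∈ s, ‖c‖ ^ 2 - ρ ^ 2 ≤ poincareRadius y.2 ^ 2) ∨
      ∀ y ∈ s, poincareRadius y.2 ^ 2 ≤ ‖c‖ ^ 2 - ρ ^ 2) :
    IsMonotoneCurve s := by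
  have hrad : ∀ r ∈ Prod.snd '' s, r ∈ Set.Ici (0 : ℝ) := by
    rintro _ ⟨y, hy, rfl⟩
    exact (hs hy).1.2.1
  refine isMonotoneCurve_of_eq (u := fun φ => Real.cos (φ - c.arg))
    (v := fun r => (poincareRadius r + (‖c‖ ^ 2 - ρ ^ 2) / poincareRadius r) / (2 * ‖c‖))
    (fun y hy => ⟨hφ y hy, Set.mem_image_of_mem _ hy⟩)
    (strictMonoOn_or_strictAntiOn_cos_sub c.arg k) ?_ fun y hy => ?_
  · have hmono := strictMonoOn_poincareRadius.monotoneOn.mono hrad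
    refine hside.imp (fun hside => ?_) fun hside => ?_
    · refine fun r hr t ht hrt => div_le_div_of_nonneg_right ?_ (by positivity)
      exact ((monotoneOn_add_div _).comp hmono
        (by rintro _ ⟨y, hy, rfl⟩; exact ⟨hpos y hy, hside y hy⟩)) hr ht hrt
    · refine fun r hr t ht hrt => div_le_div_of_nonneg_right ?_ (by positivity)
      exact ((antitoneOn_add_div _).comp_MonotoneOn hmono
        (by rintro _ ⟨y, hy, rfl⟩; exact ⟨hpos y hy, hside y hy⟩)) hr ht hrt
  · have hpos := hpos y hy
    have : 0 < ‖c‖ := norm_pos_iff.2 hc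
    have heq := poincareRadius_sq_add_of_mem_circlePoints (hs hy)
    field_simp
    linarith

/-- One of the eight arcs of a circle: the angle stays in one half-period of the cosine of the angle
seen from the origin to the centre `c`, and the arc lies on the far (`b = true`) or on the near side
of the points in which the tangents from the origin touch the circle. -/
def circleArc (R : ℝ) (c : ℂ) (ρ : ℝ) (i : Fin 4) (b : Bool) : Set PolarPoint :=
  {y ∈ circlePoints R c ρ | y.1 ∈ halfPeriod c.arg i ∧
    if b then ‖c‖ ^ 2 - ρ ^ 2 < poincareRadius y.2 ^ 2
    else poincareRadius y.2 ^ 2 ≤ ‖c‖ ^ 2 - ρ ^ 2}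

theorem isMonotoneCurve_circleArc (R : ℝ) (c : ℂ) (ρ : ℝ) (i : Fin 4) (b : Bool) :
    IsMonotoneCurve (circleArc R c ρ i b) := by
  have hsub : circleArc R c ρ i b ⊆ circlePoints R c ρ := fun y hy => hy.1
  have hroot : circleArc R c ρ i b ⊆ rootRegion R := fun y hy => hy.1.1
  obtain rfl | hc := eq_or_ne c 0
  · refine isMonotoneCurve_of_poincareRadius_sq_eq hroot (a := ρ ^ 2) fun y hy => ?_
    have := poincareRadius_sq_add_of_mem_circlePoints (hsub hy)
    simp only [norm_zero] at this
    linarith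
  cases b
  · obtain hk | hk := le_or_gt (‖c‖ ^ 2 - ρ ^ 2) 0
    · refine isMonotoneCurve_of_poincareRadius_sq_eq hroot (a := 0) fun y hy => ?_
      exact (hy.2.2.trans hk).antisymm (sq_nonneg _)
    · refine isMonotoneCurve_of_subset_circlePoints hsub (fun y hy => hy.2.1) hc (fun y hy => ?_)
        (Or.inr fun y hy => hy.2.2)
      exact (poincareRadius_nonneg _).lt_of_ne' fun h =>
        hk.ne' (norm_sq_eq_sq_of_poincareRadius_eq_zero (hsub hy) h)
  · have hfar : ∀ y ∈ circleArc R c ρ i true, ‖c‖ ^ 2 - ρ ^ 2 < poincareRadius y.2 ^ 2 :=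
      fun y hy => hy.2.2
    refine isMonotoneCurve_of_subset_circlePoints hsub (fun y hy => hy.2.1) hc (fun y hy => ?_)
      (Or.inl fun y hy => (hfar y hy).le)
    refine (poincareRadius_nonneg _).lt_of_ne' fun h => (hfar y hy).ne ?_
    rw [norm_sq_eq_sq_of_poincareRadius_eq_zero (hsub hy) h, h, zero_pow two_ne_zero]

theorem circlePoints_subset_iUnion_circleArc (R : ℝ) (c : ℂ) (ρ : ℝ) :
    circlePoints R c ρ ⊆ ⋃ i, ⋃ b, circleArc R c ρ i b := by
  intro y hy
  obtain ⟨i, hi⟩ := exists_mem_halfPeriod (Complex.arg_mem_Ioc c) hy.1.1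
  simp only [Set.mem_iUnion]
  obtain h | h := lt_or_ge (‖c‖ ^ 2 - ρ ^ 2) (poincareRadius y.2 ^ 2)
  · exact ⟨i, true, hy, hi, by simpa using h⟩
  · exact ⟨i, false, hy, hi, by simpa using h⟩

end Circle

section EqualAreaGrid

variable {α R : ℝ}

/-- The distribution function of the radial coordinate. -/
noncomputable def radialCdf (α R r : ℝ) : ℝ :=
  (Real.cosh (α * r) - 1) / (Real.cosh (α * R) - 1)

theorem cosh_mul_sub_one_pos (hα : 0 < α) (hR : 0 < R) : 0 < Real.cosh (α * R) - 1 :=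
  sub_pos.2 (Real.one_lt_cosh.2 (mul_pos hα hR).ne')

theorem strictMonoOn_radialCdf (hα : 0 < α) (hR : 0 < R) :
    StrictMonoOn (radialCdf α R) (Set.Ici 0) := by
  intro r hr r' hr' h
  have hcosh : Real.cosh (α * r) < Real.cosh (α * r') :=
    Real.cosh_strictMonoOn (mul_nonneg hα.le hr) (mul_nonneg hα.le hr')
      (mul_lt_mul_of_pos_left h hα)
  exact div_lt_div_of_pos_right (by linarith) (cosh_mul_sub_one_pos hα hR)

theorem radialCdf_zero : radialCdf α R 0 = 0 := by simp [radialCdf]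

theorem radialCdf_self (hα : 0 < α) (hR : 0 < R) : radialCdf α R R = 1 :=
  div_self (cosh_mul_sub_one_pos hα hR).ne'

theorem mem_Ico_iff_radialCdf_mem_Ico (hα : 0 < α) (hR : 0 < R) {r₀ r₁ r : ℝ} (hr₀ : 0 ≤ r₀)
    (hr₁ : 0 ≤ r₁) :
    r ∈ Set.Ico r₀ r₁ ↔
      0 ≤ r ∧ radialCdf α R r ∈ Set.Ico (radialCdf α R r₀) (radialCdf α R r₁) := by
  have hmono := strictMonoOn_radialCdf hα hR
  constructor
  · rintro ⟨h, h'⟩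
    have hr : 0 ≤ r := hr₀.trans h
    exact ⟨hr, (hmono.le_iff_le hr₀ hr).2 h, hmono hr hr₁ h'⟩
  · rintro ⟨hr, h, h'⟩
    exact ⟨(hmono.le_iff_le hr₀ hr).1 h, (hmono.lt_iff_lt hr hr₁).1 h'⟩

theorem midR_nonneg (hα : 0 < α) (C : Cell) : 0 ≤ C.midR α := by
  have h₁ := Real.one_le_cosh (α * C.minR)
  have h₂ := Real.one_le_cosh (α * C.maxR)
  exact div_nonneg (Real.arcosh_nonneg (by linarith)) hα.le

theorem radialCdf_midR (hα : 0 < α) (C : Cell) :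
    radialCdf α R (C.midR α) = (radialCdf α R C.minR + radialCdf α R C.maxR) / 2 := by
  have h₁ := Real.one_le_cosh (α * C.minR)
  have h₂ := Real.one_le_cosh (α * C.maxR)
  unfold radialCdf Cell.midR
  rw [mul_div_cancel₀ _ hα.ne', Real.cosh_arcosh (by linarith)]
  ring

/-- The index of the cell at an address in the grid of equal-area cells of its level: the bits of
the angular and of the radial choices, read as binary numbers. -/
def cellIndex : Address → ℕ × ℕ
  | [] => (0, 0)
  | q :: a => (2 * (cellIndex a).1 + q.1.toNat, 2 * (cellIndex a).2 + q.2.toNat)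

theorem cellIndex_lt (a : Address) :
    (cellIndex a).1 < 2 ^ a.length ∧ (cellIndex a).2 < 2 ^ a.length := by
  induction a with
  | nil => simp [cellIndex]
  | cons q a ih =>
    have h₁ := Bool.toNat_le q.1
    have h₂ := Bool.toNat_le q.2
    simp only [cellIndex, List.length_cons, pow_succ]
    lia

theorem eq_of_cellIndex_eq {a b : Address} (hlen : a.length = b.length)
    (h : cellIndex a = cellIndex b) : a = b := by
  induction a generalizing b with
  | nil => exact (List.length_eq_zero_iff.1 hlen.symm).symm
  | cons q a ih =>
    obtain _ | ⟨q', b⟩ := b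
    · simp at hlen
    simp only [cellIndex, Prod.ext_iff] at h
    have hab : cellIndex a = cellIndex b := by
      refine Prod.ext ?_ ?_ <;> grind [Bool.toNat_le]
    obtain rfl := ih (by simpa using hlen) hab
    have hbits : ∀ q q' : Bool × Bool,
        q.1.toNat = q'.1.toNat → q.2.toNat = q'.2.toNat → q = q' := by
      decide
    rw [hbits q q' (by lia) (by lia)]

theorem div_two_pi_cellAt (a : Address) :
    (cellAt α R a).minPhi / (2 * Real.pi) = (cellIndex a).1 / 2 ^ a.length ∧
      (cellAt α R a).maxPhi / (2 * Real.pi) = ((cellIndex a).1 + 1) / 2 ^ a.length := by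
  induction a with
  | nil => simp [cellAt, cellIndex]
  | cons q a ih =>
    obtain ⟨hmin, hmax⟩ := ih
    rw [div_eq_div_iff (by positivity) (by positivity)] at hmin hmax ⊢
    rw [div_eq_div_iff (by positivity) (by positivity)]
    cases hq : q.1 <;>
      simp only [cellAt, Cell.child, Cell.midPhi, cellIndex, hq, List.length_cons, pow_succ,
        Bool.false_eq_true, if_true, if_false, Bool.toNat_true, Bool.toNat_false] <;>
      push_cast <;> constructor <;> linarith

theorem radialCdf_cellAt (hα : 0 < α) (hR : 0 < R) (a : Address) :
    (0 ≤ (cellAt α R a).minR ∧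
        radialCdf α R (cellAt α R a).minR = (cellIndex a).2 / 2 ^ a.length) ∧
      0 ≤ (cellAt α R a).maxR ∧
        radialCdf α R (cellAt α R a).maxR = ((cellIndex a).2 + 1) / 2 ^ a.length := by
  induction a with
  | nil => simp [cellAt, cellIndex, radialCdf_zero, radialCdf_self hα hR, hR.le]
  | cons q a ih =>
    obtain ⟨⟨hmin, hFmin⟩, hmax, hFmax⟩ := ih
    have hmid := midR_nonneg hα (cellAt α R a)
    have hFmid := radialCdf_midR (R := R) hα (cellAt α R a)
    rw [hFmin, hFmax] at hFmid
    cases hq : q.2 <;>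
      simp only [cellAt, Cell.child, cellIndex, hq, List.length_cons, pow_succ,
        Bool.false_eq_true, if_true, if_false, Bool.toNat_true, Bool.toNat_false, hmin, hmax, hmid,
        hFmin, hFmax, hFmid, true_and] <;>
      push_cast <;> constructor <;> field_simp <;> ring

theorem mem_Ico_div_iff_floor_mul_eq {m A : ℕ} (hA : A < m) {v : ℝ} :
    v ∈ Set.Ico (A / m : ℝ) ((A + 1) / m) ↔ v ∈ Set.Ico 0 1 ∧ ⌊m * v⌋₊ = A := by
  have hm : (0 : ℝ) < m := by exact_mod_cast A.zero_le.trans_lt hA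
  have hA' : (A + 1 : ℝ) ≤ m := by exact_mod_cast hA
  simp only [Set.mem_Ico, div_le_iff₀' hm, lt_div_iff₀' hm]
  constructor
  · rintro ⟨h, h'⟩
    have hv : 0 ≤ v := nonneg_of_mul_nonneg_right (A.cast_nonneg.trans h) hm
    exact ⟨⟨hv, by nlinarith⟩, (Nat.floor_eq_iff (by positivity)).2 ⟨h, h'⟩⟩
  · rintro ⟨⟨hv, -⟩, h⟩
    exact (Nat.floor_eq_iff (by positivity)).1 h

theorem floor_mul_lt {m : ℕ} (hm : 0 < m) {v : ℝ} (hv : v ∈ Set.Ico (0 : ℝ) 1) : ⌊m * v⌋₊ < m := by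
  have hm : (0 : ℝ) < m := by exact_mod_cast hm
  exact (Nat.floor_lt (mul_nonneg hm.le hv.1)).2 (mul_lt_of_lt_one_right hm hv.2)

/-- The index of the cell that contains a point, in the grid that cuts the disk into `m` sectors of
equal angle and `m` annuli of equal mass. -/
noncomputable def gridIndex (α R : ℝ) (m : ℕ) (y : PolarPoint) : ℕ × ℕ :=
  (⌊m * (y.1 / (2 * Real.pi))⌋₊, ⌊m * radialCdf α R y.2⌋₊)

theorem mem_rootRegion_iff (hα : 0 < α) (hR : 0 < R) {y : PolarPoint} :
    y ∈ rootRegion R ↔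
      y.1 / (2 * Real.pi) ∈ Set.Ico 0 1 ∧ 0 ≤ y.2 ∧ radialCdf α R y.2 ∈ Set.Ico 0 1 := by
  have hr := mem_Ico_iff_radialCdf_mem_Ico hα hR (r := y.2) le_rfl hR.le
  rw [radialCdf_zero, radialCdf_self hα hR] at hr
  have hphi : y.1 ∈ Set.Ico 0 (2 * Real.pi) ↔ y.1 / (2 * Real.pi) ∈ Set.Ico 0 1 := by
    rw [Set.mem_Ico, Set.mem_Ico, le_div_iff₀ Real.two_pi_pos, div_lt_one Real.two_pi_pos, zero_mul]
  rw [rootRegion, Set.mem_prod, hphi, hr]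

theorem mem_region_cellAt_iff (hα : 0 < α) (hR : 0 < R) {a : Address} {y : PolarPoint} :
    y ∈ (cellAt α R a).region ↔
      y ∈ rootRegion R ∧ gridIndex α R (2 ^ a.length) y = cellIndex a := by
  obtain ⟨hminPhi, hmaxPhi⟩ := div_two_pi_cellAt (α := α) (R := R) a
  obtain ⟨⟨hmin, hFmin⟩, hmax, hFmax⟩ := radialCdf_cellAt hα hR a
  have hphi : y.1 ∈ Set.Ico (cellAt α R a).minPhi (cellAt α R a).maxPhi ↔
      y.1 / (2 * Real.pi) ∈ Set.Ico 0 1 ∧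
        ⌊((2 ^ a.length : ℕ) : ℝ) * (y.1 / (2 * Real.pi))⌋₊ = (cellIndex a).1 := by
    rw [← mem_Ico_div_iff_floor_mul_eq (cellIndex_lt a).1, Nat.cast_pow, Nat.cast_ofNat, ← hminPhi,
      ← hmaxPhi, Set.mem_Ico, Set.mem_Ico, div_le_div_iff_of_pos_right Real.two_pi_pos,
      div_lt_div_iff_of_pos_right Real.two_pi_pos]
  have hr : y.2 ∈ Set.Ico (cellAt α R a).minR (cellAt α R a).maxR ↔
      0 ≤ y.2 ∧ radialCdf α R y.2 ∈ Set.Ico 0 1 ∧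
        ⌊((2 ^ a.length : ℕ) : ℝ) * radialCdf α R y.2⌋₊ = (cellIndex a).2 := by
    rw [← mem_Ico_div_iff_floor_mul_eq (cellIndex_lt a).2, Nat.cast_pow, Nat.cast_ofNat, ← hFmin,
      ← hFmax, mem_Ico_iff_radialCdf_mem_Ico hα hR hmin hmax]
  rw [Cell.region, Set.mem_prod, hphi, hr, mem_rootRegion_iff hα hR, gridIndex, Prod.ext_iff]
  tauto

theorem gridIndex_eq_div (m : ℕ) {d : ℕ} (hd : 0 < d) (y : PolarPoint) :
    gridIndex α R m y =
      ((gridIndex α R (m * d) y).1 / d, (gridIndex α R (m * d) y).2 / d) := by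
  have hd : (d : ℝ) ≠ 0 := by exact_mod_cast hd.ne'
  have hfloor (v : ℝ) : ⌊m * v⌋₊ = ⌊((m * d : ℕ) : ℝ) * v⌋₊ / d := by
    rw [← Nat.floor_div_natCast, Nat.cast_mul, mul_right_comm, mul_div_cancel_right₀ _ hd]
  exact Prod.ext (hfloor _) (hfloor _)

theorem gridIndex_eq_of_dvd {m m' : ℕ} (hm' : 0 < m') (hdvd : m ∣ m') {y z : PolarPoint}
    (h : gridIndex α R m' y = gridIndex α R m' z) : gridIndex α R m y = gridIndex α R m z := by
  obtain ⟨d, rfl⟩ := hdvd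
  have hd : 0 < d := Nat.pos_of_mul_pos_left hm'
  rw [gridIndex_eq_div m hd y, gridIndex_eq_div m hd z, h]

theorem gridIndex_mem (hα : 0 < α) (hR : 0 < R) {m : ℕ} (hm : 0 < m) {y : PolarPoint}
    (hy : y ∈ rootRegion R) : gridIndex α R m y ∈ Finset.range m ×ˢ Finset.range m := by
  obtain ⟨hphi, -, hr⟩ := (mem_rootRegion_iff hα hR).1 hy
  exact Finset.mem_product.2
    ⟨Finset.mem_range.2 (floor_mul_lt hm hphi), Finset.mem_range.2 (floor_mul_lt hm hr)⟩

theorem region_cellAt_subset_rootRegion (hα : 0 < α) (hR : 0 < R) (a : Address) :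
    (cellAt α R a).region ⊆ rootRegion R :=
  fun _ hy => ((mem_region_cellAt_iff hα hR).1 hy).1

theorem mem_region_cellAt_of_gridIndex_eq (hα : 0 < α) (hR : 0 < R) {j : ℕ} {a : Address}
    (hj : a.length ≤ j) {y z : PolarPoint} (hy : y ∈ (cellAt α R a).region)
    (hz : z ∈ rootRegion R) (h : gridIndex α R (2 ^ j) y = gridIndex α R (2 ^ j) z) :
    z ∈ (cellAt α R a).region := by
  rw [mem_region_cellAt_iff hα hR] at hy ⊢
  exact ⟨hz, hy.2 ▸ (gridIndex_eq_of_dvd (by positivity) (pow_dvd_pow 2 hj) h).symm⟩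

theorem gridIndex_eq_of_mem_region_cellAt (hα : 0 < α) (hR : 0 < R) {j : ℕ} {a : Address}
    (hj : j ≤ a.length) {y z : PolarPoint} (hy : y ∈ (cellAt α R a).region)
    (hz : z ∈ (cellAt α R a).region) :
    gridIndex α R (2 ^ j) y = gridIndex α R (2 ^ j) z := by
  rw [mem_region_cellAt_iff hα hR] at hy hz
  exact gridIndex_eq_of_dvd (by positivity) (pow_dvd_pow 2 hj) (hy.2.trans hz.2.symm)

theorem region_cellAt_cons_subset (hα : 0 < α) (hR : 0 < R) (q : Bool × Bool) (a : Address) :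
    (cellAt α R (q :: a)).region ⊆ (cellAt α R a).region := by
  intro y hy
  rw [mem_region_cellAt_iff hα hR] at hy ⊢
  have h₁ := Bool.toNat_le q.1
  have h₂ := Bool.toNat_le q.2
  rw [gridIndex_eq_div _ two_pos, ← pow_succ, ← List.length_cons, hy.2]
  exact ⟨hy.1, Prod.ext (by simp only [cellIndex]; lia) (by simp only [cellIndex]; lia)⟩

theorem region_cellAt_subset_of_suffix (hα : 0 < α) (hR : 0 < R) {a b : Address} (h : a <:+ b) :
    (cellAt α R b).region ⊆ (cellAt α R a).region := by
  obtain ⟨l, rfl⟩ := h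
  induction l with
  | nil => exact subset_rfl
  | cons q l ih => exact (region_cellAt_cons_subset hα hR q (l ++ a)).trans ih

theorem suffix_of_mem_region_cellAt (hα : 0 < α) (hR : 0 < R) {a b : Address}
    (hlen : a.length ≤ b.length) {y : PolarPoint} (ha : y ∈ (cellAt α R a).region)
    (hb : y ∈ (cellAt α R b).region) : a <:+ b := by
  have hsuffix := List.drop_suffix (b.length - a.length) b
  have hlen' : (b.drop (b.length - a.length)).length = a.length := by
    rw [List.length_drop, Nat.sub_sub_self hlen]
  have hy := region_cellAt_subset_of_suffix hα hR hsuffix hb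
  rw [mem_region_cellAt_iff hα hR, hlen'] at hy
  rw [mem_region_cellAt_iff hα hR] at ha
  rwa [eq_of_cellIndex_eq hlen' (hy.2.symm.trans ha.2)] at hsuffix

end EqualAreaGrid

section Sampling

variable {ι β : Type*} [Fintype ι]

theorem setOf_le_ncard_eq_biUnion (S : Set β) (t : ℕ) :
    {x : ι → β | t ≤ {i | x i ∈ S}.ncard} =
      ⋃ s ∈ Finset.powersetCard t (Finset.univ : Finset ι), (s : Set ι).pi fun _ => S := by
  classical
  ext x
  simp only [Set.mem_ofPred_eq, Set.mem_iUnion, Set.mem_pi, Finset.mem_coe, exists_prop,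
    Finset.mem_powersetCard, Finset.subset_univ, true_and]
  rw [Set.ncard_eq_toFinset_card']
  constructor
  · intro h
    obtain ⟨s, hs, hcard⟩ := Finset.exists_subset_card_eq h
    exact ⟨s, hcard, fun i hi => by simpa using hs hi⟩
  · rintro ⟨s, rfl, hs⟩
    exact Finset.card_le_card fun i hi => by simpa using hs i hi

variable [MeasurableSpace β]

theorem measurableSet_setOf_le_ncard {ι : Type*} [Finite ι] {S : Set β} (hS : MeasurableSet S)
    (t : ℕ) :
    MeasurableSet {x : ι → β | t ≤ {i | x i ∈ S}.ncard} := by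
  have := Fintype.ofFinite ι
  rw [setOf_le_ncard_eq_biUnion]
  exact Finset.measurableSet_biUnion _ fun s _ =>
    MeasurableSet.pi s.countable_toSet fun _ _ => hS

theorem measure_pi_le_ncard_le_choose_mul_pow (μ : Measure β) [IsProbabilityMeasure μ] (S : Set β)
    (t : ℕ) :
    Measure.pi (fun _ : ι => μ) {x | t ≤ {i | x i ∈ S}.ncard} ≤
      (Fintype.card ι).choose t * μ S ^ t := by
  rw [setOf_le_ncard_eq_biUnion]
  refine (measure_biUnion_finset_le _ _).trans_eq ?_
  have hpi : ∀ s ∈ Finset.powersetCard t (Finset.univ : Finset ι),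
      Measure.pi (fun _ : ι => μ) ((s : Set ι).pi fun _ => S) = μ S ^ t := by
    intro s hs
    rw [Measure.pi_pi_finset, Finset.prod_const, (Finset.mem_powersetCard.1 hs).2]
  rw [Finset.sum_congr rfl hpi, Finset.sum_const, Finset.card_powersetCard, Finset.card_univ,
    nsmul_eq_mul]

theorem choose_mul_pow_le_exp_div (n t : ℕ) {p : ℝ} (hp : 0 ≤ p) :
    n.choose t * p ^ t ≤ Real.exp (2 * (n * p)) / 2 ^ t := by
  calc n.choose t * p ^ t ≤ n ^ t / t.factorial * p ^ t := by
        gcongr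
        exact Nat.choose_le_pow_div t n
    _ = (2 * (n * p)) ^ t / t.factorial / 2 ^ t := by
        rw [mul_pow, mul_pow]
        field_simp
    _ ≤ Real.exp (2 * (n * p)) / 2 ^ t := by
        gcongr
        exact Real.pow_div_factorial_le_exp _ (by positivity) t

theorem measure_pi_le_ncard_le_exp_div (μ : Measure β) [IsProbabilityMeasure μ] {S : Set β} {p : ℝ}
    (hp : 0 ≤ p) (hS : μ S ≤ ENNReal.ofReal p) (t : ℕ) :
    Measure.pi (fun _ : ι => μ) {x | t ≤ {i | x i ∈ S}.ncard} ≤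
      ENNReal.ofReal (Real.exp (2 * (Fintype.card ι * p)) / 2 ^ t) := by
  refine (measure_pi_le_ncard_le_choose_mul_pow μ S t).trans ?_
  calc (Fintype.card ι).choose t * μ S ^ t
      ≤ (Fintype.card ι).choose t * ENNReal.ofReal p ^ t := by gcongr
    _ = ENNReal.ofReal ((Fintype.card ι).choose t * p ^ t) := by
        rw [ENNReal.ofReal_mul (by positivity), ENNReal.ofReal_natCast, ENNReal.ofReal_pow hp]
    _ ≤ _ := ENNReal.ofReal_le_ofReal (choose_mul_pow_le_exp_div _ t hp)

end Sampling

section PointLaw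

variable {α R : ℝ}

theorem hasDerivAt_radialCdf (α R r : ℝ) :
    HasDerivAt (radialCdf α R) (radialDensity α R r) r := by
  have h := (((Real.hasDerivAt_cosh (α * r)).comp r ((hasDerivAt_id r).const_mul α)).sub_const
    1).div_const (Real.cosh (α * R) - 1)
  exact h.congr_deriv (by rw [radialDensity]; ring)

theorem radialLaw_apply (hα : 0 < α) (hR : 0 < R) {S : Set ℝ} (hS : MeasurableSet S) :
    radialLaw α R S = volume (radialCdf α R '' (S ∩ Set.Icc 0 R)) := by
  rw [radialLaw, withDensity_apply _ hS, Measure.restrict_restrict hS]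
  exact lintegral_deriv_eq_volume_image_of_monotoneOn (hS.inter measurableSet_Icc)
    (fun r _ => (hasDerivAt_radialCdf α R r).hasDerivWithinAt)
    ((strictMonoOn_radialCdf hα hR).monotoneOn.mono fun _ hr => hr.2.1)

theorem isProbabilityMeasure_radialLaw (hα : 0 < α) (hR : 0 < R) :
    IsProbabilityMeasure (radialLaw α R) := by
  refine ⟨?_⟩
  have himage : radialCdf α R '' Set.Icc 0 R = Set.Icc (radialCdf α R 0) (radialCdf α R R) :=
    ContinuousOn.image_Icc_of_monotoneOn hR.le
      (fun r _ => (hasDerivAt_radialCdf α R r).continuousAt.continuousWithinAt)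
      ((strictMonoOn_radialCdf hα hR).monotoneOn.mono Set.Icc_subset_Ici_self)
  rw [radialLaw_apply hα hR MeasurableSet.univ, Set.univ_inter, himage, radialCdf_zero,
    radialCdf_self hα hR, Real.volume_Icc, sub_zero, ENNReal.ofReal_one]

theorem measurable_radialCdf (α R : ℝ) : Measurable (radialCdf α R) :=
  (continuous_iff_continuousAt.2 fun r => (hasDerivAt_radialCdf α R r).continuousAt).measurable

theorem radialLaw_preimage_radialCdf_le (hα : 0 < α) (hR : 0 < R) (s t : ℝ) :
    radialLaw α R (radialCdf α R ⁻¹' Set.Ico s t) ≤ ENNReal.ofReal (t - s) := by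
  rw [radialLaw_apply hα hR (measurable_radialCdf α R measurableSet_Ico), ← Real.volume_Ico]
  refine measure_mono ?_
  rintro _ ⟨r, ⟨hr, -⟩, rfl⟩
  exact hr

theorem isProbabilityMeasure_angularLaw : IsProbabilityMeasure angularLaw := by
  refine ProbabilityTheory.cond_isProbabilityMeasure_of_finite ?_ ?_
  · simp [Real.pi_pos]
  · exact measure_Ico_lt_top.ne

theorem angularLaw_preimage_div_le (s t : ℝ) :
    angularLaw ((· / (2 * Real.pi)) ⁻¹' Set.Ico s t) ≤ ENNReal.ofReal (t - s) := by
  have hlength : volume ((· / (2 * Real.pi)) ⁻¹' Set.Ico s t) =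
      ENNReal.ofReal (2 * Real.pi) * ENNReal.ofReal (t - s) := by
    simp only [div_eq_mul_inv]
    rw [Real.volume_preimage_mul_right (inv_ne_zero Real.two_pi_pos.ne'), inv_inv,
      abs_of_pos Real.two_pi_pos, Real.volume_Ico]
  rw [angularLaw, ProbabilityTheory.cond_apply measurableSet_Ico, Real.volume_Ico, sub_zero,
    ENNReal.inv_mul_le_iff (by simp [Real.pi_pos]) ENNReal.ofReal_ne_top, ← hlength]
  exact measure_mono Set.inter_subset_right

theorem isProbabilityMeasure_pointLaw (hα : 0 < α) (hR : 0 < R) :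
    IsProbabilityMeasure (pointLaw α R) := by
  have := isProbabilityMeasure_radialLaw hα hR
  have := isProbabilityMeasure_angularLaw
  exact inferInstanceAs (IsProbabilityMeasure (angularLaw.prod (radialLaw α R)))

/-- The part of the disk covered by the grid cells with index in `T`. -/
def gridSet (α R : ℝ) (m : ℕ) (T : Finset (ℕ × ℕ)) : Set PolarPoint :=
  {y | y ∈ rootRegion R ∧ gridIndex α R m y ∈ T}

theorem measurable_gridIndex (α R : ℝ) (m : ℕ) : Measurable (gridIndex α R m) :=
  (Nat.measurable_floor.comp (by fun_prop)).prodMk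
    (Nat.measurable_floor.comp (((measurable_radialCdf α R).comp measurable_snd).const_mul _))

theorem measurableSet_gridSet (α R : ℝ) (m : ℕ) (T : Finset (ℕ × ℕ)) :
    MeasurableSet (gridSet α R m T) :=
  (measurableSet_Ico.prod measurableSet_Ico).inter
    (measurable_gridIndex α R m T.measurableSet)

theorem gridSet_singleton_subset (hα : 0 < α) (hR : 0 < R) {m : ℕ} (hm : 0 < m) (p : ℕ × ℕ) :
    gridSet α R m {p} ⊆
      ((· / (2 * Real.pi)) ⁻¹' Set.Ico (p.1 / m) ((p.1 + 1) / m)) ×ˢ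
        (radialCdf α R ⁻¹' Set.Ico (p.2 / m) ((p.2 + 1) / m)) := by
  rintro y ⟨hy, hp⟩
  obtain rfl := Finset.mem_singleton.1 hp
  obtain ⟨h₁, h₂⟩ := Finset.mem_product.1 (gridIndex_mem hα hR hm hy)
  obtain ⟨hphi, -, hr⟩ := (mem_rootRegion_iff hα hR).1 hy
  exact ⟨(mem_Ico_div_iff_floor_mul_eq (Finset.mem_range.1 h₁)).2 ⟨hphi, rfl⟩,
    (mem_Ico_div_iff_floor_mul_eq (Finset.mem_range.1 h₂)).2 ⟨hr, rfl⟩⟩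

theorem pointLaw_gridSet_singleton_le (hα : 0 < α) (hR : 0 < R) {m : ℕ} (hm : 0 < m) (p : ℕ × ℕ) :
    pointLaw α R (gridSet α R m {p}) ≤ ENNReal.ofReal (1 / m ^ 2) := by
  have := isProbabilityMeasure_radialLaw hα hR
  have hwidth (k : ℕ) : ((k + 1) / m - k / m : ℝ) = 1 / m := by ring
  have hangular := angularLaw_preimage_div_le (p.1 / m) ((p.1 + 1) / m)
  have hradial := radialLaw_preimage_radialCdf_le hα hR (p.2 / m) ((p.2 + 1) / m)
  rw [hwidth] at hangular hradial
  calc pointLaw α R (gridSet α R m {p})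
      ≤ _ := measure_mono (gridSet_singleton_subset hα hR hm p)
    _ = _ := Measure.prod_prod _ _
    _ ≤ ENNReal.ofReal (1 / m) * ENNReal.ofReal (1 / m) := mul_le_mul' hangular hradial
    _ = ENNReal.ofReal (1 / m ^ 2) := by
        rw [← ENNReal.ofReal_mul (by positivity), ← sq, div_pow, one_pow]

theorem pointLaw_gridSet_le (hα : 0 < α) (hR : 0 < R) {m : ℕ} (hm : 0 < m) (T : Finset (ℕ × ℕ)) :
    pointLaw α R (gridSet α R m T) ≤ ENNReal.ofReal (#T / m ^ 2) := by
  have hunion : gridSet α R m T = ⋃ p ∈ T, gridSet α R m {p} := by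
    ext y
    simp [gridSet]
  calc pointLaw α R (gridSet α R m T)
      ≤ ∑ p ∈ T, pointLaw α R (gridSet α R m {p}) := by
        rw [hunion]
        exact measure_biUnion_finset_le _ _
    _ ≤ #T • ENNReal.ofReal (1 / m ^ 2) :=
        Finset.sum_le_card_nsmul _ _ _ fun p _ => pointLaw_gridSet_singleton_le hα hR hm p
    _ = ENNReal.ofReal (#T / m ^ 2) := by
        rw [← ENNReal.ofReal_nsmul, nsmul_eq_mul, mul_one_div]

/-- The samples in which no monotone curve of cells of the `m × m` grid contains as many as `t`
points. On these samples the query bound holds for all circles at once. -/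
def sparseSamples (α R : ℝ) (n m t : ℕ) : Set (Fin n → PolarPoint) :=
  {x | ∀ T ∈ gridCurves m, {i | x i ∈ gridSet α R m T}.ncard < t}

theorem compl_sparseSamples (α R : ℝ) (n m t : ℕ) :
    (sparseSamples α R n m t)ᶜ =
      ⋃ T ∈ gridCurves m, {x | t ≤ {i | x i ∈ gridSet α R m T}.ncard} := by
  ext x
  simp [sparseSamples]

theorem measurableSet_sparseSamples (α R : ℝ) (n m t : ℕ) :
    MeasurableSet (sparseSamples α R n m t) := by
  rw [← MeasurableSet.compl_iff, compl_sparseSamples]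
  exact Finset.measurableSet_biUnion _ fun T _ =>
    measurableSet_setOf_le_ncard (measurableSet_gridSet α R m T) t

theorem measure_compl_sparseSamples_le (hα : 0 < α) (hR : 0 < R) (n : ℕ) {m : ℕ} (hm : 0 < m)
    (t : ℕ) :
    Measure.pi (fun _ : Fin n => pointLaw α R) (sparseSamples α R n m t)ᶜ ≤
      ENNReal.ofReal (2 * 32 ^ m * (Real.exp (2 * (n * (2 / m))) / 2 ^ t)) := by
  have := isProbabilityMeasure_pointLaw hα hR
  have hcurve : ∀ T ∈ gridCurves m,
      Measure.pi (fun _ : Fin n => pointLaw α R) {x | t ≤ {i | x i ∈ gridSet α R m T}.ncard} ≤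
        ENNReal.ofReal (Real.exp (2 * (n * (2 / m))) / 2 ^ t) := by
    intro T hT
    have hcard : (#T : ℝ) / m ^ 2 ≤ 2 / m := by
      have : (#T : ℝ) ≤ 2 * m := by exact_mod_cast card_le_of_mem_gridCurves hT
      have : (0 : ℝ) < m := by exact_mod_cast hm
      rw [div_le_div_iff₀ (by positivity) this]
      nlinarith
    simpa using measure_pi_le_ncard_le_exp_div (ι := Fin n) (pointLaw α R) (by positivity)
      ((pointLaw_gridSet_le hα hR hm T).trans (ENNReal.ofReal_le_ofReal hcard)) t
  have hnum : (#(gridCurves m) : ℝ) ≤ 2 * 32 ^ m := by exact_mod_cast card_gridCurves_le m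
  rw [compl_sparseSamples]
  refine (measure_biUnion_finset_le _ _).trans ((Finset.sum_le_card_nsmul _ _ _ hcurve).trans ?_)
  rw [← ENNReal.ofReal_nsmul, nsmul_eq_mul]
  gcongr

theorem exp_sixteen_mul_le_two_pow (m : ℕ) : Real.exp (16 * m) ≤ 2 ^ (24 * m) := by
  have hexp_two : Real.exp 2 ≤ 8 := by
    rw [← one_add_one_eq_two, Real.exp_add]
    nlinarith [Real.exp_pos 1, Real.exp_one_lt_d9]
  calc Real.exp (16 * m) = Real.exp 2 ^ (8 * m) := by
        rw [← Real.exp_nat_mul]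
        push_cast
        ring_nf
    _ ≤ (2 ^ 3) ^ (8 * m) := by
        gcongr
        linarith
    _ = 2 ^ (24 * m) := by
        rw [← pow_mul]
        ring_nf

theorem eight_mul_sq_le_pow {m : ℕ} (hm : 0 < m) : 8 * m ^ 2 ≤ 32 ^ m := by
  calc 8 * m ^ 2 ≤ 8 ^ m * (2 ^ m) ^ 2 := by
        gcongr
        · exact Nat.le_self_pow hm.ne' 8
        · exact Nat.lt_two_pow_self.le
    _ = 32 ^ m := by
        rw [← pow_mul, mul_comm m 2, pow_mul, ← mul_pow]
        norm_num

theorem two_mul_pow_mul_exp_div_le_inv {n m : ℕ} (hn : 0 < n) (hm : 0 < m) (hnm : n ≤ 4 * m ^ 2) :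
    2 * 32 ^ m * (Real.exp (2 * (n * (2 / m))) / 2 ^ (34 * m)) ≤ (n : ℝ)⁻¹ := by
  have hn' : (0 : ℝ) < n := by exact_mod_cast hn
  have hm' : (0 : ℝ) < m := by exact_mod_cast hm
  have hnm' : (n : ℝ) ≤ 4 * m ^ 2 := by exact_mod_cast hnm
  have hmean : 2 * (n * (2 / m)) ≤ (16 * m : ℝ) := by
    rw [← le_div_iff₀' two_pos, mul_div_assoc', div_le_iff₀ hm']
    nlinarith
  have hexp := (Real.exp_le_exp.2 hmean).trans (exp_sixteen_mul_le_two_pow m)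
  have hcount : (2 * n : ℝ) ≤ 32 ^ m := by
    exact_mod_cast (by lia : 2 * n ≤ 8 * m ^ 2).trans (eight_mul_sq_le_pow hm)
  rw [← one_div, le_div_iff₀ hn', mul_div_assoc', div_mul_eq_mul_div, div_le_one (by positivity)]
  calc 2 * 32 ^ m * Real.exp (2 * (n * (2 / m))) * n
      = 32 ^ m * Real.exp (2 * (n * (2 / m))) * (2 * n) := by ring
    _ ≤ 32 ^ m * 2 ^ (24 * m) * 32 ^ m := by gcongr
    _ = 2 ^ (34 * m) := by
        rw [show (32 : ℝ) = 2 ^ 5 by norm_num, ← pow_mul, ← pow_add, ← pow_add]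
        ring_nf

theorem one_sub_inv_le_measure_sparseSamples (hα : 0 < α) (hR : 0 < R) {n m : ℕ} (hn : 0 < n)
    (hm : 0 < m) (hnm : n ≤ 4 * m ^ 2) :
    1 - (n : ENNReal)⁻¹ ≤
      Measure.pi (fun _ : Fin n => pointLaw α R) (sparseSamples α R n m (34 * m)) := by
  have := isProbabilityMeasure_pointLaw hα hR
  rw [← compl_compl (sparseSamples α R n m (34 * m)),
    prob_compl_eq_one_sub (measurableSet_sparseSamples α R n m _).compl]
  refine tsub_le_tsub_left ((measure_compl_sparseSamples_le hα hR n hm _).trans ?_) 1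
  rw [← ENNReal.ofReal_natCast, ← ENNReal.ofReal_inv_of_pos (by exact_mod_cast hn)]
  exact ENNReal.ofReal_le_ofReal (two_mul_pow_mul_exp_div_le_inv hn hm hnm)

end PointLaw

section CircleGrid

variable {α R : ℝ}

theorem exists_mem_gridCurves_image_gridIndex_subset (hα : 0 < α) (hR : 0 < R) {m : ℕ} (hm : 0 < m)
    {s : Set PolarPoint} (hsR : s ⊆ rootRegion R) (hs : IsMonotoneCurve s) :
    ∃ T ∈ gridCurves m, gridIndex α R m '' s ⊆ T := by
  have hrange : gridIndex α R m '' s ⊆ (Finset.range m ×ˢ Finset.range m : Finset (ℕ × ℕ)) :=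
    Set.image_subset_iff.2 fun y hy => gridIndex_mem hα hR hm (hsR hy)
  have hfin : (gridIndex α R m '' s).Finite := (Finset.finite_toSet _).subset hrange
  have hcurve : IsMonotoneCurve (gridIndex α R m '' s) := by
    refine IsMonotoneCurve.image (f := fun φ => ⌊m * (φ / (2 * Real.pi))⌋₊)
      (g := fun r => ⌊m * radialCdf α R r⌋₊) hs (fun φ φ' h => ?_) ?_
    · have := Real.two_pi_pos
      exact Nat.floor_mono (by gcongr)
    · rintro _ ⟨y, hy, rfl⟩ _ ⟨z, hz, rfl⟩ h
      have := (strictMonoOn_radialCdf hα hR).monotoneOn (hsR hy).2.1 (hsR hz).2.1 h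
      exact Nat.floor_mono (by gcongr)
  refine ⟨hfin.toFinset, mem_gridCurves.2 ⟨fun p hp => hrange (by simpa using hp), ?_⟩, ?_⟩
  · rwa [hfin.coe_toFinset]
  · exact hfin.coe_toFinset.ge

theorem exists_gridCurves_cover_circlePoints (hα : 0 < α) (hR : 0 < R) {m : ℕ} (hm : 0 < m)
    (c : ℂ) (ρ : ℝ) :
    ∃ T : Fin 4 × Bool → Finset (ℕ × ℕ), (∀ k, T k ∈ gridCurves m) ∧
      gridIndex α R m '' circlePoints R c ρ ⊆ ⋃ k, T k := by
  choose T hT hsub using fun k : Fin 4 × Bool =>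
    exists_mem_gridCurves_image_gridIndex_subset hα hR hm (fun _ hy => hy.1.1)
      (isMonotoneCurve_circleArc R c ρ k.1 k.2)
  refine ⟨T, hT, ?_⟩
  rintro _ ⟨y, hy, rfl⟩
  obtain ⟨i, b, hy⟩ : ∃ i b, y ∈ circleArc R c ρ i b := by
    simpa only [Set.mem_iUnion] using circlePoints_subset_iUnion_circleArc R c ρ hy
  exact Set.mem_iUnion.2 ⟨(i, b), hsub (i, b) ⟨y, hy, rfl⟩⟩

theorem encard_image_gridIndex_circlePoints_le (hα : 0 < α) (hR : 0 < R) {m : ℕ} (hm : 0 < m)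
    (c : ℂ) (ρ : ℝ) : (gridIndex α R m '' circlePoints R c ρ).encard ≤ (8 * (2 * m) : ℕ) := by
  obtain ⟨T, hT, hsub⟩ := exists_gridCurves_cover_circlePoints hα hR hm c ρ
  refine encard_le_card_mul_of_subset_iUnion hsub fun k => ?_
  rw [Set.encard_coe_eq_coe_finsetCard]
  exact_mod_cast card_le_of_mem_gridCurves (hT k)

theorem encard_samples_near_circle_le (hα : 0 < α) (hR : 0 < R) {n m t : ℕ} (hm : 0 < m)
    {x : Fin n → PolarPoint} (hx : x ∈ sparseSamples α R n m t) (c : ℂ) (ρ : ℝ) :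
    {i | x i ∈ rootRegion R ∧
      gridIndex α R m (x i) ∈ gridIndex α R m '' circlePoints R c ρ}.encard ≤ (8 * t : ℕ) := by
  obtain ⟨T, hT, hsub⟩ := exists_gridCurves_cover_circlePoints hα hR hm c ρ
  refine encard_le_card_mul_of_subset_iUnion (A := fun k => {i | x i ∈ gridSet α R m (T k)})
    (fun i hi => ?_) fun k => ?_
  · obtain ⟨k, hk⟩ := Set.mem_iUnion.1 (hsub hi.2)
    exact Set.mem_iUnion.2 ⟨k, hi.1, hk⟩
  · rw [← (Set.toFinite _).cast_ncard_eq]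
    exact_mod_cast (hx (T k) (hT k)).le

end CircleGrid

section Query

variable {α R : ℝ} {κ n : ℕ} {x : Fin n → PolarPoint}

/-- The split nodes none of whose children is split. The parents of the bottom leaf cells are such
nodes, and their cells are disjoint. -/
def IsBottomNode (α R : ℝ) (κ : ℕ) (x : Fin n → PolarPoint) (p : Address) : Prop :=
  κ < load α R x p ∧ ∀ q, load α R x (q :: p) ≤ κ

theorem isBottomNode_of_isBottomLeaf_cons {q : Bool × Bool} {p : Address}
    (h : IsBottomLeaf α R κ x (q :: p)) : IsBottomNode α R κ x p := by
  obtain ⟨⟨hnode, hload⟩, hsibling⟩ := h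
  cases hnode with
  | child _ _ hp hsplit =>
    refine ⟨hsplit, fun q' => ?_⟩
    obtain rfl | hne := eq_or_ne q q'
    · exact hload
    · exact (hsibling (q' :: p) ⟨p, q, q', hne, rfl, rfl⟩ (.child p q' hp hsplit)).2

theorem load_le_of_suffix (hα : 0 < α) (hR : 0 < R) {a b : Address} (h : a <:+ b) :
    load α R x b ≤ load α R x a :=
  Set.ncard_le_ncard fun _ hi => region_cellAt_subset_of_suffix hα hR h hi

theorem eq_of_isBottomNode_of_suffix (hα : 0 < α) (hR : 0 < R) {p p' : Address}
    (hp : IsBottomNode α R κ x p) (hp' : IsBottomNode α R κ x p') (h : p <:+ p') : p = p' := by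
  obtain ⟨l, rfl⟩ := h
  obtain rfl | ⟨l, q, rfl⟩ := l.eq_nil_or_concat
  · rfl
  · have hsuffix : q :: p <:+ l.concat q ++ p := ⟨l, by simp⟩
    exact absurd hp'.1 (((load_le_of_suffix hα hR hsuffix).trans (hp.2 q)).not_gt)

theorem pairwiseDisjoint_region_isBottomNode (hα : 0 < α) (hR : 0 < R) :
    {p | IsBottomNode α R κ x p}.PairwiseDisjoint fun p => (cellAt α R p).region := by
  intro p hp p' hp' hne
  refine Set.disjoint_left.2 fun y hy hy' => hne ?_
  obtain hlen | hlen := le_total p.length p'.length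
  · exact eq_of_isBottomNode_of_suffix hα hR hp hp' (suffix_of_mem_region_cellAt hα hR hlen hy hy')
  · exact (eq_of_isBottomNode_of_suffix hα hR hp' hp
      (suffix_of_mem_region_cellAt hα hR hlen hy' hy)).symm

theorem exists_mem_region_of_isBottomNode {p : Address} (hp : IsBottomNode α R κ x p) :
    ∃ i, x i ∈ (cellAt α R p).region :=
  Set.nonempty_of_ncard_ne_zero (κ.zero_le.trans_lt hp.1).ne'

theorem encard_le_of_forall_isBottomNode (hα : 0 < α) (hR : 0 < R) {s : Set Address}
    {t : Set (Fin n)} (hs : ∀ p ∈ s, IsBottomNode α R κ x p)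
    (ht : ∀ p ∈ s, ∀ i, x i ∈ (cellAt α R p).region → i ∈ t) : s.encard ≤ t.encard := by
  refine encard_le_encard_of_pairwiseDisjoint (A := fun p => x ⁻¹' (cellAt α R p).region)
    (fun p hp p' hp' hne => ?_) fun p hp => ?_
  · exact (pairwiseDisjoint_region_isBottomNode hα hR (hs p hp) (hs p' hp') hne).preimage x
  · obtain ⟨i, hi⟩ := exists_mem_region_of_isBottomNode (hs p hp)
    exact ⟨i, hi, ht p hp i hi⟩

theorem region_subset_or_inter_circlePoints_nonempty (hα : 0 < α) (hR : 0 < R) {c : ℂ} {ρ : ℝ}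
    {p : Address} (h : (toPoincare '' (cellAt α R p).region ∩ Metric.closedBall c ρ).Nonempty) :
    (cellAt α R p).region ⊆ toPoincare ⁻¹' Metric.ball c ρ ∨
      ((cellAt α R p).region ∩ circlePoints R c ρ).Nonempty := by
  have hconn : IsPreconnected (toPoincare '' (cellAt α R p).region) :=
    ((convex_Ico _ _).prod (convex_Ico _ _)).isPreconnected.image _
      continuous_toPoincare.continuousOn
  obtain hsub | ⟨_, ⟨y, hy, rfl⟩, hyc⟩ := subset_ball_or_inter_sphere_nonempty hconn h
  · exact Or.inl (Set.image_subset_iff.1 hsub)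
  · exact Or.inr ⟨y, hy, region_cellAt_subset_rootRegion hα hR p hy, hyc⟩

/-- The bottom nodes whose cells meet the closed disk of a range query. -/
def queryNodes (α R : ℝ) (κ : ℕ) (x : Fin n → PolarPoint) (c : ℂ) (ρ : ℝ) : Set Address :=
  {p | IsBottomNode α R κ x p ∧
    (toPoincare '' (cellAt α R p).region ∩ Metric.closedBall c ρ).Nonempty}

theorem encard_inside_le (hα : 0 < α) (hR : 0 < R) (κ : ℕ) (x : Fin n → PolarPoint) (c : ℂ)
    (ρ : ℝ) :
    {p | IsBottomNode α R κ x p ∧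
      (cellAt α R p).region ⊆ toPoincare ⁻¹' Metric.ball c ρ}.encard ≤
      (queryResult x c ρ).encard :=
  encard_le_of_forall_isBottomNode hα hR (fun _ hp => hp.1) fun _ hp _ hi => hp.2 hi

theorem encard_crossing_deep_le (hα : 0 < α) (hR : 0 < R) (κ : ℕ) {j t : ℕ}
    (hx : x ∈ sparseSamples α R n (2 ^ j) t) (c : ℂ) (ρ : ℝ) :
    {p | IsBottomNode α R κ x p ∧ j ≤ p.length ∧
      ((cellAt α R p).region ∩ circlePoints R c ρ).Nonempty}.encard ≤ (8 * t : ℕ) := by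
  refine (encard_le_of_forall_isBottomNode hα hR (fun _ hp => hp.1) ?_).trans
    (encard_samples_near_circle_le hα hR (by positivity) hx c ρ)
  rintro p ⟨-, hj, y, hy, hyc⟩ i hi
  exact ⟨region_cellAt_subset_rootRegion hα hR p hi, y, hyc,
    gridIndex_eq_of_mem_region_cellAt hα hR hj hy hi⟩

theorem encard_crossing_shallow_le (hα : 0 < α) (hR : 0 < R) (κ : ℕ) (x : Fin n → PolarPoint)
    (j : ℕ) (c : ℂ) (ρ : ℝ) :
    {p | IsBottomNode α R κ x p ∧ p.length ≤ j ∧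
      ((cellAt α R p).region ∩ circlePoints R c ρ).Nonempty}.encard ≤ (8 * (2 * 2 ^ j) : ℕ) := by
  refine (encard_le_encard_of_pairwiseDisjoint
    (A := fun p => gridIndex α R (2 ^ j) '' (cellAt α R p).region) ?_ ?_).trans
    (encard_image_gridIndex_circlePoints_le hα hR (by positivity) c ρ)
  · rintro p ⟨hp, hj, -⟩ p' ⟨hp', -⟩ hne
    refine Set.disjoint_left.2 ?_
    rintro _ ⟨y, hy, rfl⟩ ⟨z, hz, hyz⟩
    have hz' : z ∈ (cellAt α R p).region :=
      mem_region_cellAt_of_gridIndex_eq hα hR hj hy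
        (region_cellAt_subset_rootRegion hα hR p' hz) hyz.symm
    exact (pairwiseDisjoint_region_isBottomNode hα hR hp hp' hne).notMem_of_mem_left hz' hz
  · rintro p ⟨-, -, y, hy, hyc⟩
    exact ⟨_, ⟨y, hy, rfl⟩, y, hyc, rfl⟩

theorem encard_queryNodes_le (hα : 0 < α) (hR : 0 < R) (κ : ℕ) {j t : ℕ}
    (hx : x ∈ sparseSamples α R n (2 ^ j) t) (c : ℂ) (ρ : ℝ) :
    (queryNodes α R κ x c ρ).encard ≤
      (queryResult x c ρ).encard + (8 * t : ℕ) + (8 * (2 * 2 ^ j) : ℕ) := by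
  refine (Set.encard_le_encard fun p hp => ?_).trans <| (Set.encard_union_le _ _).trans <|
    add_le_add ((Set.encard_union_le _ _).trans <|
      add_le_add (encard_inside_le hα hR κ x c ρ) (encard_crossing_deep_le hα hR κ hx c ρ))
      (encard_crossing_shallow_le hα hR κ x j c ρ)
  obtain hin | hcross := region_subset_or_inter_circlePoints_nonempty hα hR hp.2
  · exact Or.inl (Or.inl ⟨hp.1, hin⟩)
  · obtain hj | hj := le_total j p.length
    · exact Or.inl (Or.inr ⟨hp.1, hj, hcross⟩)
    · exact Or.inr ⟨hp.1, hj, hcross⟩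

theorem mem_queryNodes_of_cons_mem_examinedBottomLeaves (hα : 0 < α) (hR : 0 < R) {c : ℂ} {ρ : ℝ}
    {q : Bool × Bool} {p : Address} (h : q :: p ∈ examinedBottomLeaves α R κ x c ρ) :
    p ∈ queryNodes α R κ x c ρ := by
  obtain ⟨hleaf, hexamined⟩ := h
  cases hexamined with
  | child _ _ _ _ hmeets =>
    exact ⟨isBottomNode_of_isBottomLeaf_cons hleaf, hmeets.mono <|
      Set.inter_subset_inter_left _ (Set.image_mono (region_cellAt_cons_subset hα hR q p))⟩

theorem encard_examinedBottomLeaves_le_one_add (hα : 0 < α) (hR : 0 < R) (κ : ℕ)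
    (x : Fin n → PolarPoint) (c : ℂ) (ρ : ℝ) :
    (examinedBottomLeaves α R κ x c ρ).encard ≤ 1 + 4 * (queryNodes α R κ x c ρ).encard := by
  have hsub : examinedBottomLeaves α R κ x c ρ ⊆
      {[]} ∪ (fun z : (Bool × Bool) × Address => z.1 :: z.2) ''
        (Set.univ ×ˢ queryNodes α R κ x c ρ) := by
    rintro (_ | ⟨q, p⟩) h
    · exact Or.inl rfl
    · exact Or.inr ⟨(q, p),
        ⟨Set.mem_univ q, mem_queryNodes_of_cons_mem_examinedBottomLeaves hα hR h⟩, rfl⟩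
  refine (Set.encard_le_encard hsub).trans <| (Set.encard_union_le _ _).trans <|
    add_le_add (Set.encard_singleton _).le <| (Set.encard_image_le _ _).trans_eq ?_
  rw [Set.encard_prod, Set.encard_univ, ENat.card_eq_coe_fintype_card]
  rfl

theorem encard_examinedBottomLeaves_le (hα : 0 < α) (hR : 0 < R) (κ : ℕ) {j t : ℕ}
    (hx : x ∈ sparseSamples α R n (2 ^ j) t) (c : ℂ) (ρ : ℝ) :
    (examinedBottomLeaves α R κ x c ρ).encard ≤
      (1 + 4 * ((queryResult x c ρ).ncard + 8 * t + 8 * (2 * 2 ^ j)) : ℕ) := by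
  refine (encard_examinedBottomLeaves_le_one_add hα hR κ x c ρ).trans ?_
  have h := encard_queryNodes_le hα hR κ hx c ρ
  rw [← (Set.toFinite (queryResult x c ρ)).cast_ncard_eq] at h
  push_cast at h ⊢
  gcongr

end Query

theorem exists_sq_two_pow_le_and_le {n : ℕ} (hn : 0 < n) :
    ∃ j : ℕ, (2 ^ j) ^ 2 ≤ n ∧ n ≤ 4 * (2 ^ j) ^ 2 := by
  have hpow (j : ℕ) : (2 ^ j) ^ 2 = 4 ^ j := (pow_right_comm 2 j 2).trans rfl
  refine ⟨Nat.log 4 n, ?_, ?_⟩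
  · rw [hpow]
    exact Nat.pow_log_le_self 4 hn.ne'
  · rw [hpow, ← pow_succ']
    exact (Nat.lt_pow_succ_log_self (by norm_num) n).le

end PolarQuadtree

theorem lemma3 :
    ∃ (K : ℝ) (N : ℕ), ∀ n : ℕ, N ≤ n → ∀ (α R : ℝ) (κ : ℕ), 0 < α → 0 < R → 1 ≤ κ →
      ∃ E : Set (Fin n → PolarQuadtree.PolarPoint), MeasurableSet E ∧
        1 - (n : ENNReal)⁻¹ ≤
          MeasureTheory.Measure.pi (fun _ : Fin n => PolarQuadtree.pointLaw α R) E ∧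
        ∀ x ∈ E, ∀ (c : ℂ) (ρ : ℝ),
          (PolarQuadtree.examinedBottomLeaves α R κ x c ρ).Finite ∧
          ((PolarQuadtree.examinedBottomLeaves α R κ x c ρ).ncard : ℝ) ≤
            K * (Real.sqrt n + ((PolarQuadtree.queryResult x c ρ).ncard : ℝ)) := by
  refine ⟨1153, 1, fun n hn α R κ hα hR _ => ?_⟩
  obtain ⟨j, hj, hj'⟩ := PolarQuadtree.exists_sq_two_pow_le_and_le hn
  refine ⟨PolarQuadtree.sparseSamples α R n (2 ^ j) (34 * 2 ^ j),
    PolarQuadtree.measurableSet_sparseSamples α R n _ _,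
    PolarQuadtree.one_sub_inv_le_measure_sparseSamples hα hR hn (by positivity) hj',
    fun x hx c ρ => ?_⟩
  obtain ⟨hfin, hcard⟩ := Set.encard_le_coe_iff_finite_ncard_le.1
    (PolarQuadtree.encard_examinedBottomLeaves_le hα hR κ hx c ρ)
  refine ⟨hfin, ?_⟩
  have hsqrt : (2 ^ j : ℝ) ≤ Real.sqrt n := Real.le_sqrt_of_sq_le (by exact_mod_cast hj)
  have hcard' : ((PolarQuadtree.examinedBottomLeaves α R κ x c ρ).ncard : ℝ) ≤
      1 + 4 * ((PolarQuadtree.queryResult x c ρ).ncard + 8 * (34 * 2 ^ j) + 8 * (2 * 2 ^ j)) := by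
    exact_mod_cast hcard
  have hone : (1 : ℝ) ≤ 2 ^ j := one_le_pow₀ one_le_two
  have : (0 : ℝ) ≤ (PolarQuadtree.queryResult x c ρ).ncard := Nat.cast_nonneg _
  linarith
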